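/- Let $\mathcal M=(E,\mathcal I)$ be a matroid on a finite set $E$, and let $\mathrm{Rank}_{w}(\mathcal M)=\max\{\sum_{e\in T}w(e):T\in\mathcal I\}$ for $w\in\mathbb R_{\ge 0}^E$. A simple partition matroid on $E'$ is given by a partition of $E'$; its independent sets are the sets $S\subseteq E'$ containing at most one element of each part. Let $\alpha\in(0,1]$ and suppose that $\mathcal M$ satisfies the $\alpha$-partition property: there is a random simple partition matroid $\mathcal M'=(E',\mathcal I')$ with $E'\subseteq E$ and $\mathcal I'\subseteq\mathcal I$ such that $$\mathrm{Rank}_w(\mathcal M)\;\ge\;\mathbb E_{\mathcal M'}[\mathrm{Rank}_w(\mathcal M')]\;\ge\;\alpha\cdot \mathrm{Rank}_w(\mathcal M)\qquad\text{for every } w\in\mathbb R_{\ge0}^E .$$ An online contention resolution scheme (OCRS) for $\mathcal M$ and a known distribution $\mathcal D$ on subsets of $E$ is a randomized algorithm, whose internal randomness is independent of the random set $A\sim\mathcal D$ of active elements, to which all elements of $E$ are presented one at a time. When $e$ arrives the algorithm learns whether $e\in A$ and must irrevocably decide whether to select $e$; the selected set $I$ must always satisfy $I\subseteq A$ and $I\in\mathcal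 I$. The almighty adversary chooses the arrival order as an arbitrary function of $A$ and of the internal randomness of the algorithm. The OCRS is $c$-balanced against the almighty adversary if for every such adversary $\Pr[e\in I\mid e\in A]\ge c$ for all $e\in E$ with $\Pr[e\in A]>0$. Then $\mathcal M$ admits a $$\frac{1}{1.299}\left(1-\frac1e\right)\frac{\alpha^2}{3}\text{-balanced}$$ pairwise-independent OCRS against the almighty adversary: for every $\mu$ in the matroid polytope of $\mathcal M$ (the convex hull of the indicator vectors of the sets in $\mathcal I$) and every distribution $\mathcal D$ on subsets of $E$ with $\Pr_{A\sim\mathcal D}[e\in A]=\mu(e)$ for all $e$ and with pairwise independent events $\{e\in A\}_{e\in E}$, there is an OCRS for $\mathcal M$ and $\mathcal D$ that is $c$-balanced against the almighty adversary with this constant $c$. -/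

import Mathlib

universe u

namespace OCRS

/-- Probability, as a real number, of an event under a discrete distribution. -/
noncomputable def prob {α : Type*} (p : PMF α) (S : Set α) : ℝ :=
  (p.toOuterMeasure S).toReal

/-- Expectation of a real random variable under a discrete distribution
(only used below for random variables taking finitely many values). -/
noncomputable def expect {α : Type*} (p : PMF α) (f : α → ℝ) : ℝ :=
  ∑' a, (p a).toReal * f a

section Matroids

variable {E : Type u}

/-- The weighted rank `max {w(T) : T ⊆ S, T independent}`. -/
noncomputable def weightedRank (M : Matroid E) (w : E → ℝ) (S : Set E) : ℝ :=
  sSup {x : ℝ | ∃ T : Finset E, (T : Set E) ⊆ S ∧ M.Indep (T : Set E) ∧ x = ∑ e ∈ T, w e}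

/-- On a finite set of elements the supremum defining the weighted rank is a maximum. -/
theorem weightedRank_isGreatest [Finite E] (M : Matroid E) (w : E → ℝ) (S : Set E) :
    IsGreatest {x : ℝ | ∃ T : Finset E, (T : Set E) ⊆ S ∧ M.Indep (T : Set E) ∧
      x = ∑ e ∈ T, w e} (weightedRank M w S) := by
  have hfin : {x : ℝ | ∃ T : Finset E, (T : Set E) ⊆ S ∧ M.Indep (T : Set E) ∧
      x = ∑ e ∈ T, w e}.Finite := by
    refine (Set.finite_range (fun T : Finset E => ∑ e ∈ T, w e)).subset ?_
    rintro x ⟨T, -, -, rfl⟩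
    exact ⟨T, rfl⟩
  have hne : {x : ℝ | ∃ T : Finset E, (T : Set E) ⊆ S ∧ M.Indep (T : Set E) ∧
      x = ∑ e ∈ T, w e}.Nonempty := ⟨0, ∅, by simp, by simp, by simp⟩
  exact ⟨hne.csSup_mem hfin, fun x hx => le_csSup hfin.bddAbove hx⟩

/-- A simple partition matroid: the ground set is partitioned into parts, and a set of elements
is independent iff it contains at most one element of every part. -/
def IsSimplePartition (N : Matroid E) : Prop :=
  ∃ P : Set (Set E), P.PairwiseDisjoint id ∧ ⋃₀ P = N.E ∧
    ∀ S : Set E, N.Indep S ↔ S ⊆ N.E ∧ ∀ C ∈ P, (S ∩ C).encard ≤ 1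

/-- The `α`-partition property: there is a random simple partition matroid `N` with ground set
inside that of `M` and all independent sets independent in `M`, such that for all nonnegative
weights the expected weighted rank of `N` is within a factor `α` of the one of `M`. -/
def HasPartitionProperty (M : Matroid E) (α : ℝ) : Prop :=
  ∃ p : PMF (Matroid E),
    (∀ N ∈ p.support, IsSimplePartition N ∧ N.E ⊆ M.E ∧ ∀ I : Set E, N.Indep I → M.Indep I) ∧
    ∀ w : E → ℝ, (∀ e, 0 ≤ w e) →
      expect p (fun N => weightedRank N w N.E) ≤ weightedRank M w M.E ∧
      α * weightedRank M w M.E ≤ expect p (fun N => weightedRank N w N.E)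

/-- The matroid polytope: convex hull of the indicator vectors of the independent sets. -/
def matroidPolytope (M : Matroid E) : Set (E → ℝ) :=
  convexHull ℝ {x | ∃ I : Set E, M.Indep I ∧ x = I.indicator (fun _ => (1 : ℝ))}

/-- `D` is a pairwise independent distribution over sets of elements with marginals `μ`. -/
def IsPairwiseIndependent (D : PMF (Finset E)) (μ : E → ℝ) : Prop :=
  (∀ e, prob D {A | e ∈ A} = μ e) ∧
  ∀ e f, e ≠ f → prob D {A | e ∈ A ∧ f ∈ A} = prob D {A | e ∈ A} * prob D {A | f ∈ A}

end Matroids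

section Online

variable {E : Type u}

/-- An arrival order: a list in which every element occurs exactly once. -/
def ArrivalOrder (E : Type u) : Type u := {l : List E // l.Nodup ∧ ∀ e, e ∈ l}

/-- A deterministic online policy. Its arguments are the elements that arrived before, in order of
arrival and each with the bit telling whether it is active, then the element arriving now and its
activity bit. The value tells whether the current element is selected. -/
def Policy (E : Type u) : Type u := List (E × Bool) → E → Bool → Bool

variable [DecidableEq E]

/-- The elements which the policy `π` selects when, after the arrivals recorded in `past`, the
elements of the list arrive one after the other, `A` being the set of active elements. -/
def Policy.runFrom (π : Policy E) (A : Finset E) : List (E × Bool) → List E → Finset E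
  | _, [] => ∅
  | past, e :: l =>
    let rest := Policy.runFrom π A (past ++ [(e, decide (e ∈ A))]) l
    if π past e (decide (e ∈ A)) = true then insert e rest else rest

/-- The set of elements selected by `π` on active set `A` and arrival order `o`. -/
def Policy.run (π : Policy E) (A : Finset E) (o : ArrivalOrder E) : Finset E :=
  π.runFrom A [] o.1

/-- A (randomized) online contention resolution scheme for the matroid `M`: internal randomness,
drawn from `law`, and for each realization of it an online policy, which on every input selects
an independent set of active elements. -/
structure OnlineCRS (M : Matroid E) where
  Seed : Type u
  law : PMF Seed
  policy : Seed → Policy E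
  selects_active : ∀ s A o, (policy s).run A o ⊆ A
  feasible : ∀ s A o, M.Indep ((policy s).run A o : Set E)

/-- The joint law of the internal randomness and the active set, which are independent. -/
noncomputable def OnlineCRS.joint {M : Matroid E} (R : OnlineCRS M) (D : PMF (Finset E)) :
    PMF (R.Seed × Finset E) :=
  R.law.bind fun s => D.map fun A => (s, A)

/-- `R` is `c`-balanced for `D` against the almighty adversary: whenever the arrival order is
chosen with full knowledge of the active set and of the internal randomness,
`Pr[e selected | e active] ≥ c` for every element `e` (that is active with positive probability). -/
def OnlineCRS.IsBalancedAlmighty {M : Matroid E} (R : OnlineCRS M) (D : PMF (Finset E))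
    (c : ℝ) : Prop :=
  ∀ adversary : R.Seed → Finset E → ArrivalOrder E, ∀ e : E,
    0 < prob D {A | e ∈ A} →
    c ≤ prob (R.joint D)
          {x | e ∈ (R.policy x.1).run x.2 (adversary x.1 x.2) ∧ e ∈ x.2}
        / prob (R.joint D) {x | e ∈ x.2}

/-- `M` admits a `c`-balanced pairwise-independent online CRS against the almighty adversary.
The scheme knows the distribution `D` of the active set, hence may depend on it. -/
def AdmitsPairwiseOCRSAlmighty (M : Matroid E) (c : ℝ) : Prop :=
  ∀ μ ∈ matroidPolytope M, ∀ D : PMF (Finset E), IsPairwiseIndependent D μ →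
    ∃ R : OnlineCRS M, R.IsBalancedAlmighty D c

end Online

end OCRS

/-! The scheme draws a simple partition matroid `N` and a set `S` of admissible elements, then runs
greedy on the active elements of `S`. An active nonloop `e` in `S` is surely selected when no active
element of `S` is parallel to it in `N`. This condition does not mention the arrival order, so the
almighty adversary gains nothing. By pairwise independence and Bonferroni it has probability at
least `gain μ N S e`, that is, `μ e` times one minus the total marginal of the rivals in `S`.

By minimax (`exists_stdSimplex_le`), a law of seeds with expected gain at least `α / 4 * μ e` for
all `e` exists once each weight `w ≥ 0` has one good seed (`exists_seed_le_gain`). To find it, write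
`μ` as a mixture of independent sets `I` and apply the partition property to `w` restricted to each
`I`. Averaging yields one `N` and a fractional `q ≤ μ`, of mass at most one on rivals, with
`w`-weight at least `α` times that of `μ` (`exists_fractional_of_mixture`). Sampling `S` with
probabilities `q / (2μ)` costs a further factor 4 (`exists_quarter_le_gain`). The resulting `α / 4`
exceeds the required constant. -/

namespace OCRS

/-! ### Parallel elements in simple partition matroids. -/

section SimplePartition

variable {E : Type*} {N : Matroid E}

theorem exists_part_of_not_indep_pair {P : Set (Set E)}
    (hP : ∀ S : Set E, N.Indep S ↔ S ⊆ N.E ∧ ∀ C ∈ P, (S ∩ C).encard ≤ 1) {e f : E}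
    (he : N.Indep {e}) (hf : N.Indep {f}) (h : ¬ N.Indep {e, f}) : ∃ C ∈ P, e ∈ C ∧ f ∈ C := by
  have heE : e ∈ N.E := he.subset_ground rfl
  have hfE : f ∈ N.E := hf.subset_ground rfl
  by_contra! hC
  refine h ((hP _).2 ⟨by rintro x (rfl | rfl) <;> assumption, fun C hCP => ?_⟩)
  rw [Set.encard_le_one_iff]
  rintro a b ⟨rfl | rfl, ha⟩ ⟨rfl | rfl, hb⟩
  · rfl
  · exact absurd hb (hC C hCP ha)
  · exact absurd ha (hC C hCP hb)
  · rfl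

/-- In a simple partition matroid, being dependent is a transitive relation between elements
that are not loops. -/
theorem IsSimplePartition.not_indep_pair_trans (hN : IsSimplePartition N) {e f g : E}
    (he : N.Indep {e}) (hf : N.Indep {f}) (hg : N.Indep {g}) (hef : ¬ N.Indep {e, f})
    (heg : ¬ N.Indep {e, g}) (hfg : f ≠ g) : ¬ N.Indep {f, g} := by
  obtain ⟨P, hd, -, hP⟩ := hN
  obtain ⟨C, hC, heC, hfC⟩ := exists_part_of_not_indep_pair hP he hf hef
  obtain ⟨C', hC', heC', hgC⟩ := exists_part_of_not_indep_pair hP he hg heg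
  obtain rfl : C = C' := hd.elim_set hC hC' e heC heC'
  intro h
  have h1 := ((hP _).1 h).2 C hC
  rw [Set.encard_le_one_iff] at h1
  exact hfg (h1 f g ⟨by simp, hfC⟩ ⟨by simp, hgC⟩)

/-- A set is independent in a simple partition matroid if all its subsets with at most two
elements are. -/
theorem IsSimplePartition.indep_of_pairs (hN : IsSimplePartition N) {T : Set E}
    (h1 : ∀ e ∈ T, N.Indep {e}) (h2 : ∀ e ∈ T, ∀ f ∈ T, e ≠ f → N.Indep {e, f}) :
    N.Indep T := by
  obtain ⟨P, hd, -, hP⟩ := hN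
  refine (hP T).2 ⟨fun e he => (h1 e he).subset_ground rfl, fun C hC => ?_⟩
  rw [Set.encard_le_one_iff]
  rintro a b ⟨haT, haC⟩ ⟨hbT, hbC⟩
  by_contra hab
  have h := ((hP _).1 (h2 a haT b hbT hab)).2 C hC
  rw [Set.encard_le_one_iff] at h
  exact hab (h a b ⟨by simp, haC⟩ ⟨by simp, hbC⟩)

end SimplePartition

/-- Two distinct nonloops that are parallel in `N`. -/
def Conflict {E : Type*} (N : Matroid E) (e f : E) : Prop :=
  e ≠ f ∧ N.Indep {e} ∧ N.Indep {f} ∧ ¬ N.Indep {e, f}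

theorem Conflict.symm {E : Type*} {N : Matroid E} {e f : E} (h : Conflict N e f) :
    Conflict N f e :=
  ⟨h.1.symm, h.2.2.1, h.2.1, by rw [Set.pair_comm]; exact h.2.2.2⟩

/-! ### The greedy policy: feasibility and forced selection. -/

section Greedy

variable {E : Type*} [DecidableEq E]

open Classical in
/-- The policy that selects an active nonloop of `N` lying in `S` unless it is parallel in `N` to an
earlier active element of `S`. -/
noncomputable def greedyPolicy (N : Matroid E) (S : Finset E) : Policy E :=
  fun past e b => decide (b = true ∧ e ∈ S ∧ N.Indep {e} ∧
    ∀ x ∈ past, x.2 = true → x.1 ∈ S → ¬ Conflict N e x.1)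

theorem greedyPolicy_eq_true_iff {N : Matroid E} {S : Finset E} {past : List (E × Bool)} {e : E}
    {b : Bool} : greedyPolicy N S past e b = true ↔ b = true ∧ e ∈ S ∧ N.Indep {e} ∧
      ∀ x ∈ past, x.2 = true → x.1 ∈ S → ¬ Conflict N e x.1 := by
  simp [greedyPolicy]

theorem mem_runFrom_cons {π : Policy E} {A : Finset E} {past : List (E × Bool)} {l : List E}
    {e x : E} : x ∈ π.runFrom A past (e :: l) ↔
      (x = e ∧ π past e (decide (e ∈ A)) = true) ∨
        x ∈ π.runFrom A (past ++ [(e, decide (e ∈ A))]) l := by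
  simp only [Policy.runFrom]
  split_ifs with h <;> simp [h]

theorem of_mem_greedy_runFrom {N : Matroid E} {S A : Finset E} {l : List E} {x : E} :
    ∀ {past : List (E × Bool)}, x ∈ (greedyPolicy N S).runFrom A past l →
      x ∈ A ∧ x ∈ S ∧ N.Indep {x} ∧ ∀ y ∈ past, y.2 = true → y.1 ∈ S → ¬ Conflict N x y.1 := by
  induction l with
  | nil => intro past h; simp [Policy.runFrom] at h
  | cons e l ih =>
    intro past h
    rcases mem_runFrom_cons.1 h with ⟨rfl, h⟩ | h
    · simpa using greedyPolicy_eq_true_iff.1 h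
    · obtain ⟨h1, h2, h3, h4⟩ := ih h
      exact ⟨h1, h2, h3, fun y hy => h4 y (List.mem_append_left _ hy)⟩

theorem not_conflict_of_mem_greedy_runFrom {N : Matroid E} {S A : Finset E} {l : List E} {x y : E} :
    ∀ {past : List (E × Bool)}, x ∈ (greedyPolicy N S).runFrom A past l →
      y ∈ (greedyPolicy N S).runFrom A past l → ¬ Conflict N x y := by
  induction l with
  | nil => intro past h; simp [Policy.runFrom] at h
  | cons e l ih =>
    intro past hx hy
    -- The later of two selected elements was tested against the earlier one, which is active and in
    -- `S`.
    have key : ∀ {z : E}, greedyPolicy N S past e (decide (e ∈ A)) = true →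
        z ∈ (greedyPolicy N S).runFrom A (past ++ [(e, decide (e ∈ A))]) l →
        ¬ Conflict N z e := by
      intro z he hz
      obtain ⟨h1, h2, -⟩ := greedyPolicy_eq_true_iff.1 he
      exact (of_mem_greedy_runFrom hz).2.2.2 (e, decide (e ∈ A)) (by simp) h1 h2
    rcases mem_runFrom_cons.1 hx with ⟨rfl, hx⟩ | hx <;>
      rcases mem_runFrom_cons.1 hy with ⟨rfl, hy⟩ | hy
    · exact fun h => h.1 rfl
    · exact fun h => key hx hy h.symm
    · exact key hy hx
    · exact ih hx hy

/-- Only active elements of `S` can block `e`, so the criterion is free of the order `l`; the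
assumption on `past` says that recorded active bits are truthful. -/
theorem mem_greedy_runFrom {N : Matroid E} {S A : Finset E} {l : List E} {e : E}
    (heA : e ∈ A) (heS : e ∈ S) (heN : N.Indep {e}) (h : ∀ f ∈ A, f ∈ S → ¬ Conflict N e f)
    (hel : e ∈ l) : ∀ {past : List (E × Bool)}, (∀ y ∈ past, y.2 = true → y.1 ∈ A) →
      e ∈ (greedyPolicy N S).runFrom A past l := by
  induction l with
  | nil => simp at hel
  | cons a l ih =>
    intro past hp
    rw [mem_runFrom_cons]
    rcases List.mem_cons.1 hel with rfl | hel
    · exact Or.inl ⟨rfl, greedyPolicy_eq_true_iff.2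
        ⟨by simpa using heA, heS, heN, fun y hy hy2 hyS => h _ (hp y hy hy2) hyS⟩⟩
    · refine Or.inr (ih hel fun y hy hy2 => ?_)
      rcases List.mem_append.1 hy with hy | hy
      · exact hp y hy hy2
      · obtain rfl := List.mem_singleton.1 hy
        simpa using hy2

/-- The scheme that draws a simple partition matroid and a set of admissible elements, and runs the
greedy policy. -/
noncomputable def greedyCRS (M : Matroid E) (X : Set (Matroid E))
    (hX : ∀ N ∈ X, IsSimplePartition N ∧ ∀ I : Set E, N.Indep I → M.Indep I)
    (law : PMF (X × Finset E)) : OnlineCRS M where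
  Seed := X × Finset E
  law := law
  policy s := greedyPolicy s.1.1 s.2
  selects_active s A o x hx := (of_mem_greedy_runFrom hx).1
  feasible s A o := by
    refine (hX _ s.1.2).2 _ ((hX _ s.1.2).1.indep_of_pairs
      (fun e he => (of_mem_greedy_runFrom he).2.2.1) fun e he f hf hef => ?_)
    by_contra h
    exact not_conflict_of_mem_greedy_runFrom he hf
      ⟨hef, (of_mem_greedy_runFrom he).2.2.1, (of_mem_greedy_runFrom hf).2.2.1, h⟩

end Greedy

/-! ### Averaging, minimax and independent sampling. -/

section Averaging

theorem exists_le_of_weighted_sum_le {ι : Type*} [Fintype ι] {c y : ι → ℝ} {x : ℝ}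
    (hc : c ∈ stdSimplex ℝ ι) (h : x ≤ ∑ i, c i * y i) : ∃ i, c i ≠ 0 ∧ x ≤ y i := by
  by_contra! hlt
  obtain ⟨i, -, hi⟩ : ∃ i ∈ Finset.univ, 0 < c i :=
    Finset.exists_lt_of_sum_lt (by simp [hc.2])
  have : ∑ i, c i * y i < ∑ i, c i * x := by
    refine Finset.sum_lt_sum (fun j _ => ?_)
      ⟨i, Finset.mem_univ i, mul_lt_mul_of_pos_left (hlt i hi.ne') hi⟩
    rcases eq_or_ne (c j) 0 with hj | hj
    · simp [hj]
    · exact mul_le_mul_of_nonneg_left (hlt j hj).le (hc.1 j)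
  rw [← Finset.sum_mul, hc.2, one_mul] at this
  linarith

/-- A point of the convex hull of finitely many vectors is a mixture of them. -/
theorem exists_stdSimplex_of_mem_convexHull {ι E : Type*} [Fintype ι] {v : ι → E → ℝ}
    {x : E → ℝ} (hx : x ∈ convexHull ℝ (Set.range v)) :
    ∃ l ∈ stdSimplex ℝ ι, ∀ e, x e = ∑ i, l i * v i e := by
  classical
  have hsub : convexHull ℝ (Set.range v) ⊆ Fintype.linearCombination ℝ v '' stdSimplex ℝ ι := by
    refine convexHull_min ?_ ((convex_stdSimplex ℝ ι).linear_image _)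
    rintro _ ⟨i, rfl⟩
    exact ⟨Pi.single i 1, single_mem_stdSimplex ℝ i, by simp⟩
  obtain ⟨l, hl, rfl⟩ := hsub hx
  exact ⟨l, hl, fun e => by simp [Fintype.linearCombination_apply]⟩

/-- Minimax: if for all nonnegative weights some vector `g i` has weight at least that of `t`, then
some mixture of the vectors `g i` dominates `t`. -/
theorem exists_stdSimplex_le {ι E : Type*} [Fintype ι] [Fintype E] (g : ι → E → ℝ) (t : E → ℝ)
    (h : ∀ w : E → ℝ, (∀ e, 0 ≤ w e) → ∃ i, ∑ e, w e * t e ≤ ∑ e, w e * g i e) :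
    ∃ l ∈ stdSimplex ℝ ι, ∀ e, t e ≤ ∑ i, l i * g i e := by
  classical
  by_contra! hno
  -- If no mixture dominates `t`, the compact hull of the `g i` is strictly separated from the
  -- closed orthant above `t`; the separating functional provides a weight contradicting `h`.
  have hdisj : Disjoint (convexHull ℝ (Set.range g)) (Set.Ici t) := by
    rw [Set.disjoint_left]
    intro x hx hxt
    obtain ⟨l, hl, hlx⟩ := exists_stdSimplex_of_mem_convexHull hx
    obtain ⟨e, he⟩ := hno l hl
    exact absurd (hxt e) (by rw [hlx e]; exact not_le.2 he)
  obtain ⟨φ, u, v, hu, huv, hv⟩ := geometric_hahn_banach_compact_closed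
    (convex_convexHull ℝ _) ((Set.finite_range g).isCompact_convexHull ℝ) (convex_Ici t) isClosed_Ici
    hdisj
  have hφ : ∀ x, φ x = ∑ e, φ (Pi.single e 1) * x e := by
    intro x
    conv_lhs => rw [pi_eq_sum_univ' x]
    simp only [map_sum, map_smul, smul_eq_mul, mul_comm]
  have hw : ∀ e, 0 ≤ φ (Pi.single e 1) := by
    intro e
    by_contra! hneg
    have hvt : v < φ t := hv t (le_refl t)
    -- Moving up from `t` by `r` along `e` brings `φ` down to exactly `v`, which the strict bound on
    -- the orthant forbids.
    set r : ℝ := (φ t - v) / (-φ (Pi.single e 1)) with hr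
    have hr0 : 0 ≤ r := div_nonneg (by linarith) (by linarith)
    have h1 := hv (t + r • Pi.single e 1) (by
      intro f
      have : (0 : ℝ) ≤ (Pi.single e 1 : E → ℝ) f := by
        by_cases hf : f = e <;> simp [hf]
      have := mul_nonneg hr0 this
      simpa using this)
    rw [map_add, map_smul, smul_eq_mul] at h1
    have h2 : r * (-φ (Pi.single e 1)) = φ t - v := div_mul_cancel₀ _ (by linarith)
    linarith
  obtain ⟨i, hi⟩ := h _ hw
  rw [← hφ, ← hφ] at hi
  have h1 := hu (g i) (subset_convexHull ℝ _ ⟨i, rfl⟩)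
  have h2 := hv t (le_refl t)
  linarith

/-- Independent sampling of the elements with prescribed probabilities. -/
theorem exists_stdSimplex_finset_sampling {E : Type*} [Fintype E] [DecidableEq E] {b : E → ℝ}
    (h0 : ∀ e, 0 ≤ b e) (h1 : ∀ e, b e ≤ 1) :
    ∃ W ∈ stdSimplex ℝ (Finset E), ∀ T : Finset E,
      ∑ S, W S * (if T ⊆ S then 1 else 0) = ∏ e ∈ T, b e := by
  let W : Finset E → ℝ := fun S => (∏ e ∈ S, b e) * ∏ e ∈ Sᶜ, (1 - b e)
  have hW : ∀ T : Finset E, ∑ S, W S * (if T ⊆ S then 1 else 0) = ∏ e ∈ T, b e := by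
    intro T
    -- With second summand zero on `T`, the expansion keeps only the sets `S ⊇ T`, and each factor
    -- outside `T` equals one.
    have h := Fintype.prod_add b (fun e => if e ∈ T then 0 else 1 - b e)
    have hl : ∏ e, (b e + if e ∈ T then 0 else 1 - b e) = ∏ e ∈ T, b e := by
      refine Eq.trans (Finset.prod_congr rfl fun e _ => ?_) (Fintype.prod_ite_mem T b)
      split_ifs <;> ring
    rw [← hl, h]
    refine Finset.sum_congr rfl fun S _ => ?_
    simp only [W, mul_assoc]
    congr 1
    split_ifs with hT
    · rw [mul_one]
      refine Finset.prod_congr rfl fun e he => ?_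
      rw [if_neg fun heT => (Finset.mem_compl.1 he) (hT heT)]
    · obtain ⟨e, heT, heS⟩ := Finset.not_subset.1 hT
      rw [mul_zero, Finset.prod_eq_zero (Finset.mem_compl.2 heS) (by simp [heT])]
  refine ⟨W, ⟨fun S => mul_nonneg (Finset.prod_nonneg fun e _ => h0 e)
    (Finset.prod_nonneg fun e _ => sub_nonneg.2 (h1 e)), by simpa using hW ∅⟩, hW⟩

end Averaging

/-! ### Rounding a fractional solution to a set of admissible elements. -/

section Rounding

variable {E : Type*} [Fintype E] [DecidableEq E]

open Classical in
/-- A lower bound for the probability that the greedy policy must select `e`, where `μ` are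
the marginals of the pairwise independent active set. -/
noncomputable def gain (μ : E → ℝ) (N : Matroid E) (S : Finset E) (e : E) : ℝ :=
  if e ∈ S ∧ N.Indep {e} then μ e * (1 - ∑ f ∈ S with Conflict N e f, μ f) else 0

-- Keeping `e` with probability `x * q e / μ e` gives expected gain at least `x * (1 - x) * q e`,
-- since the rivals of `e` carry `q`-mass at most one. The choice `x = 1 / 2` gives the quarter, and
-- some `S` is at least as good as the average.
open Classical in
theorem exists_quarter_le_gain {μ q w : E → ℝ} {N : Matroid E} (hw : ∀ e, 0 ≤ w e)
    (hq0 : ∀ e, 0 ≤ q e) (hqμ : ∀ e, q e ≤ μ e) (hqN : ∀ e, ¬ N.Indep {e} → q e = 0)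
    (hq1 : ∀ e, ∑ f with Conflict N e f, q f ≤ 1) :
    ∃ S : Finset E, 1 / 4 * ∑ e, w e * q e ≤ ∑ e, w e * gain μ N S e := by
  let b : E → ℝ := fun e => q e / μ e / 2
  have hb0 : ∀ e, 0 ≤ b e := fun e =>
    div_nonneg (div_nonneg (hq0 e) ((hq0 e).trans (hqμ e))) two_pos.le
  have hb1 : ∀ e, b e ≤ 1 := fun e => by
    have := div_le_one_of_le₀ (hqμ e) ((hq0 e).trans (hqμ e))
    simp only [b]; linarith
  have hbμ : ∀ e, μ e * b e = q e / 2 := fun e => by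
    rcases eq_or_ne (μ e) 0 with h | h
    · have : q e = 0 := le_antisymm (h ▸ hqμ e) (hq0 e)
      simp [h, this]
    · simp only [b]; field_simp
  obtain ⟨W, hW, hWT⟩ := exists_stdSimplex_finset_sampling hb0 hb1
  suffices h : _ ≤ ∑ S, W S * ∑ e, w e * gain μ N S e from
    (exists_le_of_weighted_sum_le hW h).imp fun S hS => hS.2
  simp_rw [Finset.mul_sum]
  rw [Finset.sum_comm]
  refine Finset.sum_le_sum fun e _ => ?_
  by_cases he : N.Indep {e}
  swap
  · simp [gain, he, hqN e he]
  -- The gain becomes linear in containment indicators of singletons and pairs, whose expectations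
  -- the sampling identity supplies.
  have hgain : ∀ S, gain μ N S e = μ e * ((if {e} ⊆ S then 1 else 0) -
      ∑ f with Conflict N e f, μ f * if {e, f} ⊆ S then 1 else 0) := by
    intro S
    by_cases heS : e ∈ S
    · simp only [gain, heS, he, Finset.sum_filter, Finset.insert_subset_iff, and_self, if_true,
        Finset.singleton_subset_iff, true_and]
      congr 2
      rw [← Finset.sum_subset (Finset.subset_univ S) fun f _ hf => by simp [hf]]
      exact Finset.sum_congr rfl fun f hf => by simp [hf]
    · simp [gain, heS, Finset.insert_subset_iff]
  have hsum : ∑ S, W S * gain μ N S e =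
      q e / 2 * (1 - (∑ f with Conflict N e f, q f) / 2) := by
    calc ∑ S, W S * gain μ N S e
        = μ e * (∑ S, W S * (if {e} ⊆ S then 1 else 0) - ∑ f with Conflict N e f,
            μ f * ∑ S, W S * (if {e, f} ⊆ S then 1 else 0)) := by
          simp_rw [hgain, Finset.mul_sum]
          rw [Finset.sum_comm, ← Finset.sum_sub_distrib, Finset.mul_sum]
          refine Finset.sum_congr rfl fun S _ => ?_
          rw [mul_sub, mul_sub, mul_sub, Finset.mul_sum, Finset.mul_sum, Finset.mul_sum]
          congr 1
          · ring
          · exact Finset.sum_congr rfl fun f _ => by ring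
      _ = μ e * (b e - ∑ f with Conflict N e f, μ f * (b e * b f)) := by
          rw [hWT, Finset.prod_singleton]
          congr 2
          refine Finset.sum_congr rfl fun f hf => ?_
          rw [hWT, Finset.prod_pair (Finset.mem_filter.1 hf).2.1]
      _ = μ e * b e * (1 - ∑ f with Conflict N e f, μ f * b f) := by
          rw [mul_assoc, mul_sub (b e), mul_one, Finset.mul_sum]
          congr 2
          exact Finset.sum_congr rfl fun f _ => by ring
      _ = _ := by simp_rw [hbμ, Finset.sum_div]
  have hswap : ∑ S, W S * (w e * gain μ N S e) = w e * ∑ S, W S * gain μ N S e := by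
    rw [Finset.mul_sum]
    exact Finset.sum_congr rfl fun S _ => by ring
  rw [hswap, hsum]
  have h1 : q e / 4 ≤ q e / 2 * (1 - (∑ f with Conflict N e f, q f) / 2) := by
    nlinarith [mul_nonneg (hq0 e) (sub_nonneg.2 (hq1 e))]
  calc 1 / 4 * (w e * q e) = w e * (q e / 4) := by ring
    _ ≤ _ := mul_le_mul_of_nonneg_left h1 (hw e)

end Rounding

theorem finite_matroid {E : Type*} [Finite E] : Finite (Matroid E) :=
  Finite.of_injective (fun N : Matroid E => (N.E, {I | N.Indep I})) fun N N' h => by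
    simp only [Prod.mk.injEq] at h
    exact Matroid.ext_indep h.1 fun I _ => Set.ext_iff.1 h.2 I

theorem toReal_mem_stdSimplex {ι : Type*} [Fintype ι] (p : PMF ι) :
    (fun i => (p i).toReal) ∈ stdSimplex ℝ ι := by
  refine ⟨fun i => ENNReal.toReal_nonneg, ?_⟩
  rw [← ENNReal.toReal_sum fun i _ => p.apply_ne_top i, ← tsum_fintype (L := .unconditional ι),
    p.tsum_coe, ENNReal.toReal_one]

theorem exists_stdSimplex_of_mem_matroidPolytope {E : Type*} {M : Matroid E} {μ : E → ℝ}
    (hμ : μ ∈ matroidPolytope M) [Fintype {I : Set E // M.Indep I}] :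
    ∃ l ∈ stdSimplex ℝ {I : Set E // M.Indep I},
      ∀ e, μ e = ∑ I, l I * I.1.indicator (fun _ => (1 : ℝ)) e := by
  refine exists_stdSimplex_of_mem_convexHull
    (v := fun I : {I : Set E // M.Indep I} => I.1.indicator fun _ => (1 : ℝ)) ?_
  convert hμ using 1
  refine congrArg _ (Set.ext fun x => ?_)
  constructor
  · rintro ⟨I, rfl⟩
    exact ⟨I.1, I.2, rfl⟩
  · rintro ⟨I, hI, rfl⟩
    exact ⟨⟨I, hI⟩, rfl⟩

/-! ### A good seed for each fixed weight. -/

section Minimax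

variable {E : Type*} [Fintype E]

open Classical in
/-- Choosing in every set of a random family a maximum weight independent set of a simple partition
matroid yields a fractional solution that is feasible for the partition matroid. -/
theorem exists_fractional_of_mixture {ι : Type*} [Fintype ι] {l : ι → ℝ}
    (hl : l ∈ stdSimplex ℝ ι) (v : ι → Set E) {μ : E → ℝ}
    (hμ : ∀ e, μ e = ∑ i, l i * (v i).indicator (fun _ => (1 : ℝ)) e) {N : Matroid E}
    (hN : IsSimplePartition N) (w : E → ℝ) :
    ∃ q : E → ℝ, (∀ e, 0 ≤ q e) ∧ (∀ e, q e ≤ μ e) ∧ (∀ e, ¬ N.Indep {e} → q e = 0) ∧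
      (∀ e, ∑ f with Conflict N e f, q f ≤ 1) ∧
      ∑ e, w e * q e =
        ∑ i, l i * weightedRank N (fun e => w e * (v i).indicator (fun _ => (1 : ℝ)) e) N.E := by
  have hT : ∀ i, ∃ T : Finset E, N.Indep (T : Set E) ∧
      weightedRank N (fun e => w e * (v i).indicator (fun _ => (1 : ℝ)) e) N.E =
        ∑ e ∈ T, w e * (v i).indicator (fun _ => (1 : ℝ)) e := fun i => by
    obtain ⟨T, -, h1, h2⟩ := (weightedRank_isGreatest N
      (fun e => w e * (v i).indicator (fun _ => (1 : ℝ)) e) N.E).1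
    exact ⟨T, h1, h2⟩
  choose T hTN hTw using hT
  have hind : ∀ i e, 0 ≤ (v i).indicator (fun _ => (1 : ℝ)) e := fun i e =>
    Set.indicator_nonneg (fun _ _ => zero_le_one) e
  have hind1 : ∀ i e, (v i).indicator (fun _ => (1 : ℝ)) e ≤ 1 := fun i e =>
    Set.indicator_le' (fun _ _ => le_rfl) (fun _ _ => zero_le_one) e
  refine ⟨fun e => ∑ i, l i * if e ∈ T i then (v i).indicator (fun _ => (1 : ℝ)) e else 0,
    fun e => ?_, fun e => ?_, fun e he => ?_, fun e => ?_, ?_⟩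
  · refine Finset.sum_nonneg fun i _ => mul_nonneg (hl.1 i) ?_
    split_ifs
    exacts [hind i e, le_rfl]
  · rw [hμ]
    refine Finset.sum_le_sum fun i _ => mul_le_mul_of_nonneg_left ?_ (hl.1 i)
    split_ifs
    exacts [le_rfl, hind i e]
  · refine Finset.sum_eq_zero fun i _ => ?_
    rw [if_neg fun h => he ((hTN i).subset (by simpa using h)), mul_zero]
  · rw [Finset.sum_comm]
    refine (Finset.sum_le_sum fun i _ => ?_).trans_eq hl.2
    rw [← Finset.mul_sum]
    refine mul_le_of_le_one_right (hl.1 i) ?_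
    calc ∑ f with Conflict N e f, (if f ∈ T i then (v i).indicator (fun _ => (1 : ℝ)) f else 0)
        ≤ ∑ f with Conflict N e f, if f ∈ T i then 1 else 0 := by
          refine Finset.sum_le_sum fun f _ => ?_
          split_ifs
          exacts [hind1 i f, le_rfl]
      _ = (({f | Conflict N e f} : Finset E) ∩ T i).card := by simp
      _ ≤ 1 := by
          -- Rivals of `e` are pairwise parallel, so the independent set `T i` contains at most one
          -- of them.
          rw [Nat.cast_le_one, Finset.card_le_one]
          intro f hf g hg
          simp only [Finset.mem_inter, Finset.mem_filter_univ] at hf hg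
          by_contra hfg
          refine hN.not_indep_pair_trans hf.1.2.1 hf.1.2.2.1 hg.1.2.2.1 hf.1.2.2.2 hg.1.2.2.2
            hfg ((hTN i).subset ?_)
          rintro x (rfl | rfl)
          exacts [hf.2, hg.2]
  · simp_rw [Finset.mul_sum]
    rw [Finset.sum_comm]
    refine Finset.sum_congr rfl fun i _ => ?_
    rw [hTw, Finset.mul_sum, ← Finset.sum_subset (Finset.subset_univ (T i))
      fun e _ he => by simp [he]]
    refine Finset.sum_congr rfl fun e he => ?_
    rw [if_pos he]
    ring

theorem exists_seed_le_gain [DecidableEq E] {M : Matroid E} {α : ℝ} {p : PMF (Matroid E)} (hα0 : 0 ≤ α)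
    (hp : ∀ N ∈ p.support, IsSimplePartition N)
    (hpα : ∀ w : E → ℝ, (∀ e, 0 ≤ w e) →
      α * weightedRank M w M.E ≤ expect p (fun N => weightedRank N w N.E))
    {μ : E → ℝ} (hμ : μ ∈ matroidPolytope M) {w : E → ℝ} (hw : ∀ e, 0 ≤ w e) :
    ∃ s : p.support × Finset E,
      ∑ e, w e * (α / 4 * μ e) ≤ ∑ e, w e * gain μ s.1.1 s.2 e := by
  classical
  have := finite_matroid (E := E)
  have := Fintype.ofFinite (Matroid E)
  obtain ⟨l, hl, hlμ⟩ := exists_stdSimplex_of_mem_matroidPolytope hμ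
  let u : {I : Set E // M.Indep I} → E → ℝ := fun I e =>
    w e * I.1.indicator (fun _ => (1 : ℝ)) e
  have hu : ∀ I e, 0 ≤ u I e := fun I e =>
    mul_nonneg (hw e) (Set.indicator_nonneg (fun _ _ => zero_le_one) e)
  have hrank : ∀ I, ∑ e, u I e ≤ weightedRank M (u I) M.E := fun I => by
    refine (weightedRank_isGreatest M (u I) M.E).2 ⟨I.1.toFinset, ?_, ?_, ?_⟩
    · simpa using I.2.subset_ground
    · simpa using I.2
    · symm
      exact Finset.sum_subset (Finset.subset_univ _) fun e _ he => by
        simp only [Set.mem_toFinset] at he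
        simp [u, he]
  -- The partition property is applied to `w` restricted to `I`, whose rank in `M` is at least the
  -- weight of `I`; averaging over `I` recovers `μ`.
  have havg : α * ∑ e, w e * μ e ≤
      ∑ N, (p N).toReal * ∑ I, l I * weightedRank N (u I) N.E := by
    calc α * ∑ e, w e * μ e = ∑ I, l I * (α * ∑ e, u I e) := by
          simp_rw [hlμ, Finset.mul_sum]
          rw [Finset.sum_comm]
          refine Finset.sum_congr rfl fun I _ => Finset.sum_congr rfl fun e _ => ?_
          simp only [u]
          ring
      _ ≤ ∑ I, l I * expect p (fun N => weightedRank N (u I) N.E) :=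
          Finset.sum_le_sum fun I _ => mul_le_mul_of_nonneg_left
            ((mul_le_mul_of_nonneg_left (hrank I) hα0).trans (hpα _ (hu I))) (hl.1 I)
      _ = _ := by
          simp_rw [expect, tsum_fintype, Finset.mul_sum]
          rw [Finset.sum_comm]
          exact Finset.sum_congr rfl fun N _ => Finset.sum_congr rfl fun I _ => by ring
  obtain ⟨N, hN0, hN⟩ := exists_le_of_weighted_sum_le (toReal_mem_stdSimplex p) havg
  -- The averaging lemma returns a nonzero coefficient precisely so that `N` is known to be a simple
  -- partition matroid.
  have hNp : N ∈ p.support := fun h => hN0 (by simp [h])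
  obtain ⟨q, hq0, hqμ, hqN, hq1, hq⟩ :=
    exists_fractional_of_mixture hl (fun I => I.1) hlμ (hp N hNp) w
  obtain ⟨S, hS⟩ := exists_quarter_le_gain hw hq0 hqμ hqN hq1
  refine ⟨(⟨N, hNp⟩, S), le_trans ?_ hS⟩
  rw [hq]
  calc ∑ e, w e * (α / 4 * μ e) = 1 / 4 * (α * ∑ e, w e * μ e) := by
        simp_rw [Finset.mul_sum]
        exact Finset.sum_congr rfl fun e _ => by ring
    _ ≤ _ := mul_le_mul_of_nonneg_left hN (by norm_num)

end Minimax

/-! ### From expected gain to balancedness. -/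

section Balance

theorem prob_eq_sum {ι : Type*} [Fintype ι] (p : PMF ι) (S : Set ι) :
    prob p S = ∑ i, S.indicator (fun i => (p i).toReal) i := by
  classical
  rw [prob, PMF.toOuterMeasure_apply_fintype, ENNReal.toReal_sum]
  · exact Finset.sum_congr rfl fun i _ => by simp only [Set.indicator]; split_ifs <;> simp
  · intro i _
    simp only [Set.indicator]
    split_ifs
    exacts [p.apply_ne_top i, ENNReal.zero_ne_top]

variable {E : Type*} [Fintype E] [DecidableEq E]

/-- Bonferroni: the probability that the greedy policy is forced to select `e`. -/
theorem gain_le_prob {D : PMF (Finset E)} {μ : E → ℝ} (hD : IsPairwiseIndependent D μ)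
    (N : Matroid E) (S : Finset E) (e : E) :
    gain μ N S e ≤
      prob D {A | e ∈ A ∧ e ∈ S ∧ N.Indep {e} ∧ ∀ f ∈ A, f ∈ S → ¬ Conflict N e f} := by
  classical
  rw [gain]
  split_ifs with he
  swap
  · exact ENNReal.toReal_nonneg
  have h2 : ∀ f ∈ S.filter (Conflict N e), μ e * μ f = prob D {A | e ∈ A ∧ f ∈ A} :=
    fun f hf => by rw [hD.2 e f (Finset.mem_filter.1 hf).2.1, hD.1, hD.1]
  rw [mul_sub, mul_one, Finset.mul_sum, Finset.sum_congr rfl h2, ← hD.1 e, sub_le_iff_le_add]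
  simp_rw [prob_eq_sum]
  rw [Finset.sum_comm, ← Finset.sum_add_distrib]
  -- The union bound is checked for each active set: when `e` is active but not forced, some active
  -- rival in `S` pays for it.
  refine Finset.sum_le_sum fun A _ => ?_
  have hnn : ∀ (T : Set (Finset E)), 0 ≤ T.indicator (fun A => (D A).toReal) A := fun T =>
    Set.indicator_nonneg (fun _ _ => ENNReal.toReal_nonneg) A
  by_cases heA : e ∈ A
  swap
  · rw [Set.indicator_of_notMem (by simpa using heA)]
    exact add_nonneg (hnn _) (Finset.sum_nonneg fun _ _ => hnn _)
  rw [Set.indicator_of_mem (by simpa using heA)]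
  by_cases hc : ∀ f ∈ A, f ∈ S → ¬ Conflict N e f
  · rw [Set.indicator_of_mem (by exact ⟨heA, he.1, he.2, hc⟩)]
    exact le_add_of_nonneg_right (Finset.sum_nonneg fun _ _ => hnn _)
  · push Not at hc
    obtain ⟨f, hfA, hfS, hf⟩ := hc
    refine le_add_of_nonneg_of_le (hnn _) (le_trans ?_ (Finset.single_le_sum
      (fun _ _ => hnn _) (Finset.mem_filter.2 ⟨hfS, hf⟩)))
    rw [Set.indicator_of_mem (by exact ⟨heA, hfA⟩)]

theorem OnlineCRS.prob_joint {M : Matroid E} (R : OnlineCRS M) [Fintype R.Seed]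
    (D : PMF (Finset E)) (X : Set (R.Seed × Finset E)) :
    prob (R.joint D) X = ∑ s, (R.law s).toReal * prob D {A | (s, A) ∈ X} := by
  have hset : ∀ s : R.Seed,
      (D.map fun A => (s, A)).toOuterMeasure X = D.toOuterMeasure {A | (s, A) ∈ X} := fun s => by
    rw [PMF.toOuterMeasure_map_apply]
    rfl
  simp only [prob, OnlineCRS.joint, PMF.toOuterMeasure_bind_apply, hset]
  rw [tsum_fintype, ENNReal.toReal_sum]
  · simp
  · intro s _
    refine ENNReal.mul_ne_top (R.law.apply_ne_top s) (ne_top_of_le_ne_top ENNReal.one_ne_top ?_)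
    rw [PMF.toOuterMeasure_apply, ← D.tsum_coe]
    exact ENNReal.tsum_le_tsum fun A => Set.indicator_le_self _ _ A

theorem greedyCRS_isBalancedAlmighty {M : Matroid E} {X : Set (Matroid E)}
    (hX : ∀ N ∈ X, IsSimplePartition N ∧ ∀ I : Set E, N.Indep I → M.Indep I)
    (law : PMF (X × Finset E)) {D : PMF (Finset E)} {μ : E → ℝ}
    (hD : IsPairwiseIndependent D μ) [Fintype (X × Finset E)] {c : ℝ}
    (hc : ∀ e, c * μ e ≤ ∑ s, (law s).toReal * gain μ s.1.1 s.2 e) :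
    (greedyCRS M X hX law).IsBalancedAlmighty D c := by
  intro adversary e he
  let : Fintype (greedyCRS M X hX law).Seed := ‹Fintype (X × Finset E)›
  have hlaw := toReal_mem_stdSimplex (greedyCRS M X hX law).law
  have hden : prob ((greedyCRS M X hX law).joint D) {x | e ∈ x.2} = μ e := by
    rw [OnlineCRS.prob_joint]
    simp only [Set.mem_ofPred_eq, hD.1 e]
    rw [← Finset.sum_mul, hlaw.2, one_mul]
  rw [hden, le_div_iff₀ (hD.1 e ▸ he), OnlineCRS.prob_joint]
  refine (hc e).trans (Finset.sum_le_sum fun s _ => mul_le_mul_of_nonneg_left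
    ((gain_le_prob hD s.1.1 s.2 e).trans ?_) (hlaw.1 s))
  simp_rw [prob_eq_sum]
  -- The forced event lies inside the selection event for whatever order the adversary returns.
  refine Finset.sum_le_sum fun A _ => Set.indicator_le_indicator_of_subset ?_
    (fun _ => ENNReal.toReal_nonneg) A
  rintro A ⟨heA, heS, heN, hconf⟩
  exact ⟨mem_greedy_runFrom heA heS heN hconf ((adversary s A).2.2 e) (by simp), heA⟩

end Balance

/-- The partition property with factor `α` gives an `α / 4`-balanced scheme. -/
theorem HasPartitionProperty.admitsPairwiseOCRSAlmighty {E : Type*} [Fintype E] [DecidableEq E]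
    {M : Matroid E} {α : ℝ} (hα0 : 0 ≤ α) (hM : HasPartitionProperty M α) {c : ℝ}
    (hc : c ≤ α / 4) : AdmitsPairwiseOCRSAlmighty M c := by
  classical
  intro μ hμ D hD
  obtain ⟨p, hp, hpα⟩ := hM
  have := finite_matroid (E := E)
  have := Fintype.ofFinite (p.support × Finset E)
  obtain ⟨l, hl, hlμ⟩ := exists_stdSimplex_le (fun s : p.support × Finset E => gain μ s.1.1 s.2)
    (fun e => α / 4 * μ e) fun w hw =>
      exists_seed_le_gain hα0 (fun N hN => (hp N hN).1) (fun w hw => (hpα w hw).2) hμ hw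
  let law : PMF (p.support × Finset E) := PMF.ofFintype (fun s => ENNReal.ofReal (l s)) (by
    rw [← ENNReal.ofReal_sum_of_nonneg fun s _ => hl.1 s, hl.2, ENNReal.ofReal_one])
  have hμ0 : ∀ e, 0 ≤ μ e := fun e => hD.1 e ▸ ENNReal.toReal_nonneg
  refine ⟨greedyCRS M p.support (fun N hN => ⟨(hp N hN).1, (hp N hN).2.2⟩) law,
    greedyCRS_isBalancedAlmighty _ law hD fun e => ?_⟩
  refine (mul_le_mul_of_nonneg_right hc (hμ0 e)).trans ((hlμ e).trans_eq ?_)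
  exact Finset.sum_congr rfl fun s _ => by
    simp [law, PMF.ofFintype_apply, ENNReal.toReal_ofReal (hl.1 s)]

end OCRS

theorem mainTheorem7 {E : Type*} [Fintype E] [DecidableEq E] (M : Matroid E) (α : ℝ)
    (hα0 : 0 < α) (hα1 : α ≤ 1) (hM : OCRS.HasPartitionProperty M α) :
    OCRS.AdmitsPairwiseOCRSAlmighty M
      ((1 / 1.299) * (1 - 1 / Real.exp 1) * (α ^ 2 / 3)) := by
  refine hM.admitsPairwiseOCRSAlmighty hα0.le ?_
  -- From `e < 3` one gets `1 - 1 / e ≤ 2 / 3`, so the constant is at most about `0.172 * α ^ 2`,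
  -- below `α / 4` because `α ≤ 1`.
  have h3 : 1 / 3 ≤ 1 / Real.exp 1 :=
    one_div_le_one_div_of_le (Real.exp_pos 1) (by linarith [Real.exp_one_lt_d9])
  calc 1 / 1.299 * (1 - 1 / Real.exp 1) * (α ^ 2 / 3)
      ≤ 1 / 1.299 * (2 / 3) * (α ^ 2 / 3) := by gcongr; linarith
    _ ≤ α / 4 := by nlinarith
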